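/- For a topological space $X$, let $C_k(X)$ be the space of continuous functions $X\to\mathbb R$ with the compact-open topology. Let *Arens space* $S_2$ be the set $$\{(0,0)\}\cup\{(\tfrac1n,0):n\ge 1\}\cup\{(\tfrac1n,\tfrac1{nm}):n,m\ge 1\}\subset\mathbb R^2$$ (with $n,m$ integers), carrying the strongest topology that induces the planar topology on each of the sets $C_0=\{(0,0)\}\cup\{(\frac1n,0):n\ge1\}$ and $C_n=\{(\frac1n,0)\}\cup\{(\frac1n,\frac1{nm}):m\ge1\}$, $n\ge1$. Let the *sequential fan* be the quotient space $S_\omega=S_2/C_0$, obtained from $S_2$ by identifying the points of $C_0$ to a single point. A topological space $Y$ has the property *AP* if, whenever $A\subset Y$ and $x\in\overline{A}\setminus A$, there is $B\subset A$ with $x\in\overline{B}\subset A\cup\{x\}$. **Theorem.** If $X$ is a metrizable space which is not locally compact, then $C_k(X)$ has a closed subspace homeomorphic to $S_2$ and a closed subspace homeomorphic to $S_\omega$. Moreover, $C_k(X)$ does not have the property AP. -/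

import Mathlib

/-- The underlying set of Arens's space:
`{(0,0), (1/n,0), (1/n,1/(nm)) : n, m positive integers}`, a subset of the plane. -/
def arensPoints : Set (ℝ × ℝ) :=
  {p | p = (0, 0) ∨ (∃ n : ℕ, 0 < n ∧ p = (1 / (n : ℝ), 0)) ∨
    ∃ n m : ℕ, 0 < n ∧ 0 < m ∧ p = (1 / (n : ℝ), 1 / ((n : ℝ) * (m : ℝ)))}

/-- The convergent sequences in the plane which determine the topology of Arens's space:
`C₀ = {(0,0)} ∪ {(1/n,0) : n > 0}`, and
`Cₙ = {(1/n,0)} ∪ {(1/n,1/(nm)) : m > 0}` for `n > 0`. -/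
def arensSeq (n : ℕ) : Set (ℝ × ℝ) :=
  if n = 0 then {p | p = (0, 0) ∨ ∃ k : ℕ, 0 < k ∧ p = (1 / (k : ℝ), 0)}
  else {p | p = (1 / (n : ℝ), 0) ∨
    ∃ m : ℕ, 0 < m ∧ p = (1 / (n : ℝ), 1 / ((n : ℝ) * (m : ℝ)))}

theorem arensSeq_subset (n : ℕ) : arensSeq n ⊆ arensPoints := by
  intro p hp
  unfold arensSeq at hp
  split_ifs at hp with hn
  · rcases hp with h | h
    · exact Or.inl h
    · exact Or.inr (Or.inl h)
  · rcases hp with h | ⟨m, hm, h⟩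
    · exact Or.inr (Or.inl ⟨n, Nat.pos_of_ne_zero hn, h⟩)
    · exact Or.inr (Or.inr ⟨n, m, Nat.pos_of_ne_zero hn, hm, h⟩)

/-- Arens's space `S₂`. This is a new type, so that it does not carry the planar topology. -/
def ArensSpace : Type := ↥arensPoints

/-- The inclusion of the `n`-th convergent sequence (with its planar topology) in `S₂`. -/
def arensIncl (n : ℕ) : ↥(arensSeq n) → ArensSpace :=
  Set.inclusion (arensSeq_subset n)

/-- The topology of `S₂`: the strongest (finest) topology inducing the planar topology on every
`Cₙ`, i.e. the final topology with respect to the inclusions of the `Cₙ`: a set is open iff its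
trace on every `Cₙ` is open in the planar topology of `Cₙ`. -/
instance ArensSpace.instTopologicalSpace : TopologicalSpace ArensSpace :=
  ⨆ n : ℕ, TopologicalSpace.coinduced (arensIncl n) inferInstance

/-- The equivalence relation on `S₂` which identifies the points of `C₀` with each other, and
identifies no other points. -/
def fanSetoid : Setoid ArensSpace where
  r x y := x = y ∨ (x ∈ Set.range (arensIncl 0) ∧ y ∈ Set.range (arensIncl 0))
  iseqv :=
    { refl := fun _ => Or.inl rfl
      symm := by
        rintro x y (h | ⟨hx, hy⟩)
        · exact Or.inl h.symm
        · exact Or.inr ⟨hy, hx⟩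
      trans := by
        rintro x y z (rfl | ⟨hx, hy⟩) h
        · exact h
        · rcases h with rfl | ⟨_, hz⟩
          · exact Or.inr ⟨hx, hy⟩
          · exact Or.inr ⟨hx, hz⟩ }

/-- The sequential fan `S_ω = S₂ / C₀`. -/
def SequentialFan : Type := Quotient fanSetoid

/-- The sequential fan carries the quotient topology. -/
instance SequentialFan.instTopologicalSpace : TopologicalSpace SequentialFan :=
  inferInstanceAs (TopologicalSpace (Quotient fanSetoid))

/-- `Z` contains a closed copy of `Y`: some closed subspace of `Z` is homeomorphic to `Y`. -/
def ContainsClosedCopy (Y Z : Type*) [TopologicalSpace Y] [TopologicalSpace Z] : Prop :=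
  ∃ F : Set Z, IsClosed F ∧ Nonempty (Y ≃ₜ ↥F)

/-- The property AP: whenever `x ∈ cl A \ A`, there is `B ⊆ A` such that
`x ∈ cl B ⊆ A ∪ {x}`. -/
def PropertyAP (Y : Type*) [TopologicalSpace Y] : Prop :=
  ∀ (A : Set Y) (x : Y), x ∈ closure A \ A →
    ∃ B : Set Y, B ⊆ A ∧ x ∈ closure B ∧ closure B ⊆ A ∪ {x}

open Filter Topology

/-! At a point `a` without compact neighbourhoods, every closed ball of radius `1/(n+1)` contains a
sequence with no convergent subsequence. Narrow bumps around its terms form a row, and a compact set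
meets only finitely many supports of each row, so each row tends to `0` in `C_k(X)`. Hence sending
the spine of `S₂` to the constants `c/n` and the leaves to `c/n` plus bumps is continuous
(`continuous_arensMap`). The value `c = 1` embeds `S₂`; `c = 0` collapses the spine and embeds
`S_ω`.

The heart is `isClosedMap_arensMap`: near a function outside the image of a closed set `A`, only
points of `A` in finitely many of the compact sequences `Cₙ` matter. Away from `0` this holds
because at a fixed point of `X` all late rows vanish. At `0` it is detected on a compact set made of
`a` and finitely many peaks per row. AP passes to closed subspaces and fails in `S₂`. -/

/-! ### Points and topology of Arens's space -/

/-- A function on a nontrivial convergent sequence together with its limit is continuous as soon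
as it preserves the limit. -/
theorem continuous_of_tendsto_of_cover {S Y : Type*} [TopologicalSpace S] [T2Space S]
    [TopologicalSpace Y] {s : ℕ → S} {a : S} (hs : Tendsto s atTop (𝓝 a)) (ha : ∀ m, s m ≠ a)
    (cover : ∀ p, p = a ∨ ∃ m, p = s m) {f : S → Y}
    (hf : Tendsto (fun m => f (s m)) atTop (𝓝 (f a))) : Continuous f := by
  rw [continuous_iff_continuousAt]
  intro p
  rcases cover p with rfl | ⟨m, rfl⟩
  · intro V hV
    obtain ⟨M, hM⟩ := eventually_atTop.1 (hf hV)
    have hfin : (s '' Set.Iio M).Finite := (Set.finite_Iio M).image s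
    have hmem : (s '' Set.Iio M)ᶜ ∈ 𝓝 p :=
      hfin.isClosed.isOpen_compl.mem_nhds (by rintro ⟨i, -, hi⟩; exact ha i hi)
    refine mem_map.2 (mem_of_superset hmem fun q hq => ?_)
    rcases cover q with rfl | ⟨i, rfl⟩
    · exact mem_of_mem_nhds (x := f q) hV
    · exact hM i (not_lt.1 fun hi => hq ⟨i, hi, rfl⟩)
  -- A point other than the limit is isolated: a neighbourhood disjoint from a tail is finite.
  · obtain ⟨U, V, hU, hV, hmU, haV, hUV⟩ := t2_separation (ha m)
    obtain ⟨M, hM⟩ := eventually_atTop.1 (hs (hV.mem_nhds haV))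
    have hsub : U ⊆ s '' Set.Iio M := by
      intro q hq
      rcases cover q with rfl | ⟨i, rfl⟩
      · exact (Set.disjoint_left.1 hUV hq haV).elim
      · exact ⟨i, not_le.1 fun hi => Set.disjoint_left.1 hUV hq (hM i hi), rfl⟩
    have hopen : IsOpen {s m} := isOpen_singleton_of_finite_mem_nhds (s m)
      (hU.mem_nhds hmU) (((Set.finite_Iio M).image s).subset hsub)
    rw [ContinuousAt, (isOpen_singleton_iff_nhds_eq_pure (s m)).1 hopen]
    exact tendsto_pure_left.2 fun _ h => mem_of_mem_nhds h

namespace ArensSpace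

/-- The point `(1/n, 0)`; for `n = 0` this is the origin. -/
noncomputable def spine (n : ℕ) : ArensSpace :=
  ⟨(1 / (n : ℝ), 0), by
    rcases Nat.eq_zero_or_pos n with rfl | hn
    · left; simp
    · exact Or.inr (Or.inl ⟨n, hn, rfl⟩)⟩

/-- The point `(1/n, 1/(nm))` with `n` and `m` shifted by one. -/
noncomputable def leaf (n m : ℕ) : ArensSpace :=
  ⟨(1 / ((n + 1 : ℕ) : ℝ), 1 / (((n + 1 : ℕ) : ℝ) * ((m + 1 : ℕ) : ℝ))),
    Or.inr (Or.inr ⟨n + 1, m + 1, n.succ_pos, m.succ_pos, rfl⟩)⟩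

theorem eq_spine_or_leaf (p : ArensSpace) : (∃ n, p = spine n) ∨ ∃ n m, p = leaf n m := by
  obtain ⟨p, rfl | ⟨n, hn, rfl⟩ | ⟨n, m, hn, hm, rfl⟩⟩ := p
  · exact Or.inl ⟨0, Subtype.ext (by simp [spine])⟩
  · exact Or.inl ⟨n, rfl⟩
  · obtain ⟨n, rfl⟩ := Nat.exists_eq_succ_of_ne_zero hn.ne'
    obtain ⟨m, rfl⟩ := Nat.exists_eq_succ_of_ne_zero hm.ne'
    exact Or.inr ⟨n, m, rfl⟩

theorem leaf_snd_ne_zero (n m : ℕ) : (leaf n m).1.2 ≠ 0 := by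
  simp only [leaf]; positivity

theorem spine_ne_leaf (k n m : ℕ) : spine k ≠ leaf n m := fun h =>
  leaf_snd_ne_zero n m (h ▸ rfl)

/-- The point `(1/n, 0)` in the sequence `C₀`. -/
noncomputable def trunkPoint (n : ℕ) : ↥(arensSeq 0) :=
  ⟨(1 / (n : ℝ), 0), by
    rcases Nat.eq_zero_or_pos n with rfl | hn
    · simp [arensSeq]
    · rw [arensSeq, if_pos rfl]
      exact Or.inr ⟨n, hn, rfl⟩⟩

/-- The limit point of the sequence `Cₙ₊₁`. -/
noncomputable def branchLimit (n : ℕ) : ↥(arensSeq (n + 1)) :=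
  ⟨(1 / ((n + 1 : ℕ) : ℝ), 0), by simp [arensSeq]⟩

/-- The points of the sequence `Cₙ₊₁`. -/
noncomputable def branchPoint (n m : ℕ) : ↥(arensSeq (n + 1)) :=
  ⟨(1 / ((n + 1 : ℕ) : ℝ), 1 / (((n + 1 : ℕ) : ℝ) * ((m + 1 : ℕ) : ℝ))), by
    rw [arensSeq, if_neg n.succ_ne_zero]
    exact Or.inr ⟨m + 1, m.succ_pos, rfl⟩⟩

theorem trunk_cover (p : ↥(arensSeq 0)) :
    p = trunkPoint 0 ∨ ∃ m, p = trunkPoint (m + 1) := by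
  obtain ⟨p, hp⟩ := p
  have hp' := hp
  rw [arensSeq, if_pos rfl] at hp'
  rcases hp' with rfl | ⟨k, hk, rfl⟩
  · exact Or.inl (Subtype.ext (by simp [trunkPoint]))
  · obtain ⟨k, rfl⟩ := Nat.exists_eq_succ_of_ne_zero hk.ne'
    exact Or.inr ⟨k, rfl⟩

theorem branch_cover (n : ℕ) (p : ↥(arensSeq (n + 1))) :
    p = branchLimit n ∨ ∃ m, p = branchPoint n m := by
  obtain ⟨p, hp⟩ := p
  have hp' := hp
  rw [arensSeq, if_neg n.succ_ne_zero] at hp'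
  rcases hp' with rfl | ⟨k, hk, rfl⟩
  · exact Or.inl rfl
  · obtain ⟨k, rfl⟩ := Nat.exists_eq_succ_of_ne_zero hk.ne'
    exact Or.inr ⟨k, rfl⟩

theorem tendsto_trunkPoint :
    Tendsto (fun m => trunkPoint (m + 1)) atTop (𝓝 (trunkPoint 0)) := by
  rw [tendsto_subtype_rng]
  have h : Tendsto (fun m : ℕ => 1 / ((m + 1 : ℕ) : ℝ)) atTop (𝓝 0) := by
    simpa using tendsto_one_div_add_atTop_nhds_zero_nat (𝕜 := ℝ)
  simpa [trunkPoint] using h.prodMk_nhds (tendsto_const_nhds (x := (0 : ℝ)))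

theorem tendsto_branchPoint (n : ℕ) :
    Tendsto (branchPoint n) atTop (𝓝 (branchLimit n)) := by
  rw [tendsto_subtype_rng]
  have h : Tendsto (fun m : ℕ => 1 / ((m + 1 : ℕ) : ℝ)) atTop (𝓝 0) := by
    simpa using tendsto_one_div_add_atTop_nhds_zero_nat (𝕜 := ℝ)
  have h2 := h.const_mul (1 / ((n + 1 : ℕ) : ℝ))
  rw [mul_zero] at h2
  refine (tendsto_const_nhds.prodMk_nhds h2).congr fun m => ?_
  simp [branchPoint, mul_comm]

theorem continuous_arensIncl (n : ℕ) : Continuous (arensIncl n) :=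
  continuous_iff_coinduced_le.2
    (le_iSup (fun n => TopologicalSpace.coinduced (arensIncl n) inferInstance) n)

theorem tendsto_spine : Tendsto (fun n => spine (n + 1)) atTop (𝓝 (spine 0)) :=
  ((continuous_arensIncl 0).tendsto _).comp tendsto_trunkPoint

theorem tendsto_leaf (n : ℕ) : Tendsto (leaf n) atTop (𝓝 (spine (n + 1))) :=
  ((continuous_arensIncl (n + 1)).tendsto _).comp (tendsto_branchPoint n)

/-- The topology is final for the `Cₙ`, so only their limits have to be checked. -/
theorem continuous_of_tendsto {Y : Type*} [TopologicalSpace Y] {f : ArensSpace → Y}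
    (h₀ : Tendsto (fun n => f (spine (n + 1))) atTop (𝓝 (f (spine 0))))
    (h : ∀ n, Tendsto (fun m => f (leaf n m)) atTop (𝓝 (f (spine (n + 1))))) :
    Continuous f := by
  refine continuous_iSup_dom.2 fun n => continuous_coinduced_dom.2 ?_
  rcases n with _ | n
  · refine continuous_of_tendsto_of_cover tendsto_trunkPoint (fun m hm => ?_) trunk_cover h₀
    have := congrArg (fun p => p.1.1) hm
    simp only [trunkPoint, Nat.cast_zero, div_zero] at this
    exact (by positivity : (1 / ((m + 1 : ℕ) : ℝ)) ≠ 0) this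
  · exact continuous_of_tendsto_of_cover (tendsto_branchPoint n)
      (fun m hm => spine_ne_leaf (n + 1) n m (congrArg (arensIncl (n + 1)) hm).symm)
      (branch_cover n) (h n)

theorem isCompact_range_arensIncl (n : ℕ) : IsCompact (Set.range (arensIncl n)) := by
  rcases n with _ | n
  · convert tendsto_spine.isCompact_insert_range using 1
    ext p
    constructor
    · rintro ⟨q, rfl⟩
      rcases trunk_cover q with rfl | ⟨m, rfl⟩
      · exact Or.inl rfl
      · exact Or.inr ⟨m, rfl⟩
    · rintro (rfl | ⟨m, rfl⟩)
      exacts [⟨trunkPoint 0, rfl⟩, ⟨trunkPoint (m + 1), rfl⟩]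
  · convert (tendsto_leaf n).isCompact_insert_range using 1
    ext p
    constructor
    · rintro ⟨q, rfl⟩
      rcases branch_cover n q with rfl | ⟨m, rfl⟩
      · exact Or.inl rfl
      · exact Or.inr ⟨m, rfl⟩
    · rintro (rfl | ⟨m, rfl⟩)
      exacts [⟨branchLimit n, rfl⟩, ⟨branchPoint n m, rfl⟩]

/-- The union of the sequences `C₀, …, C_N`. -/
def level (N : ℕ) : Set ArensSpace := ⋃ n ∈ Set.Iic N, Set.range (arensIncl n)

theorem isCompact_level (N : ℕ) : IsCompact (level N) :=
  (Set.finite_Iic N).isCompact_biUnion fun n _ => isCompact_range_arensIncl n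

theorem spine_mem_range (n : ℕ) : spine n ∈ Set.range (arensIncl 0) := ⟨trunkPoint n, rfl⟩

theorem exists_spine_of_mem_range {p : ArensSpace} (hp : p ∈ Set.range (arensIncl 0)) :
    ∃ n, p = spine n := by
  obtain ⟨q, rfl⟩ := hp
  rcases trunk_cover q with rfl | ⟨m, rfl⟩
  exacts [⟨0, rfl⟩, ⟨m + 1, rfl⟩]

theorem spine_mem_level (N n : ℕ) : spine n ∈ level N :=
  Set.mem_biUnion (Set.mem_Iic.2 N.zero_le) (spine_mem_range n)

theorem leaf_mem_level {N n : ℕ} (h : n < N) (m : ℕ) : leaf n m ∈ level N :=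
  Set.mem_biUnion (Set.mem_Iic.2 h) ⟨branchPoint n m, rfl⟩

/-- Arens's space does not have the property AP. -/
theorem not_propertyAP : ¬ PropertyAP ArensSpace := by
  intro h
  have hspine (n : ℕ) : spine (n + 1) ∈ closure (Set.range fun q : ℕ × ℕ => leaf q.1 q.2) :=
    mem_closure_of_tendsto (tendsto_leaf n) (Eventually.of_forall fun m => ⟨(n, m), rfl⟩)
  have horigin : spine 0 ∈ closure (Set.range fun q : ℕ × ℕ => leaf q.1 q.2) :=
    isClosed_closure.mem_of_tendsto tendsto_spine (Eventually.of_forall hspine)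
  have hnot (k : ℕ) : spine k ∉ Set.range fun q : ℕ × ℕ => leaf q.1 q.2 := by
    rintro ⟨q, hq⟩
    exact spine_ne_leaf k q.1 q.2 hq.symm
  obtain ⟨B, hBA, hxB, hB⟩ := h _ (spine 0) ⟨horigin, hnot 0⟩
  -- With the Sierpiński topology on `Prop`, this says that `B` is closed. No point of the spine
  -- except the origin lies in the closure of `B`, so `B` is eventually avoided along every row.
  have hcont : Continuous fun p => p ∉ B := by
    refine continuous_of_tendsto ?_ fun n => ?_
    · have h1 (k : ℕ) : (spine k ∉ B) = True := eq_true fun hk => hnot k (hBA hk)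
      simp only [h1]
      exact tendsto_const_nhds
    · have h1 : spine (n + 1) ∉ closure B := by
        intro hc
        rcases hB hc with hc | hc
        · exact hnot _ hc
        · have := congrArg (fun p => p.1.1) (Set.mem_singleton_iff.1 hc)
          simp only [spine, Nat.cast_zero, div_zero] at this
          exact (by positivity : (1 / ((n + 1 : ℕ) : ℝ)) ≠ 0) this
      have h2 : (spine (n + 1) ∉ B) = True := eq_true fun hk => h1 (subset_closure hk)
      rw [h2, tendsto_nhds_true]
      filter_upwards [(tendsto_leaf n) (isClosed_closure.isOpen_compl.mem_nhds h1)] with m hm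
      exact fun hk => hm (subset_closure hk)
  have hclosed : IsClosed B := ⟨continuous_Prop.1 hcont⟩
  exact hnot 0 (hBA (hclosed.closure_eq ▸ hxB))

end ArensSpace

/-! ### Transfer along closed embeddings -/

theorem Topology.IsClosedEmbedding.containsClosedCopy {Y Z : Type*} [TopologicalSpace Y]
    [TopologicalSpace Z] {f : Y → Z} (hf : IsClosedEmbedding f) : ContainsClosedCopy Y Z :=
  ⟨Set.range f, hf.isClosed_range, ⟨hf.isEmbedding.toHomeomorph⟩⟩

/-- A closed embedding commutes with closures, so the set `B` found in `Z` can be pulled back. -/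
theorem PropertyAP.of_isClosedEmbedding {Y Z : Type*} [TopologicalSpace Y]
    [TopologicalSpace Z] {f : Y → Z} (hf : IsClosedEmbedding f) (h : PropertyAP Z) :
    PropertyAP Y := by
  rintro A x ⟨hx, hxA⟩
  obtain ⟨B, hBA, hxB, hB⟩ := h (f '' A) (f x)
    ⟨hf.closure_image_eq A ▸ Set.mem_image_of_mem f hx,
      fun h => hxA (hf.injective.mem_set_image.1 h)⟩
  obtain ⟨B, rfl⟩ : ∃ B' : Set Y, f '' B' = B :=
    ⟨f ⁻¹' B, Set.image_preimage_eq_of_subset (hBA.trans (Set.image_subset_range f A))⟩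
  rw [hf.closure_image_eq] at hxB hB
  refine ⟨B, (Set.image_subset_image_iff hf.injective).1 hBA,
    hf.injective.mem_set_image.1 hxB, fun y hy => ?_⟩
  rcases hB (Set.mem_image_of_mem f hy) with h | h
  · exact Or.inl (hf.injective.mem_set_image.1 h)
  · exact Or.inr (hf.injective h)

/-! ### Arrays of bump functions around a point without compact neighbourhoods -/

/-- A double sequence of points whose rows shrink to `base`, together with bump functions of
pairwise distinct heights peaking at these points, such that each row of bump functions tends to
zero uniformly on compact sets. -/
structure BumpArray (X : Type*) [TopologicalSpace X] where
  base : X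
  pt : ℕ → ℕ → X
  bump : ℕ → ℕ → C(X, ℝ)
  bump_le : ∀ n m z, bump n m z ≤ Nat.pair n m + 1
  bump_pt : ∀ n m, bump n m (pt n m) = Nat.pair n m + 1
  bump_base : ∀ n m, bump n m base = 0
  eventually_eq_zero : ∀ K, IsCompact K → ∀ n, ∀ᶠ m in atTop, ∀ z ∈ K, bump n m z = 0
  exists_eq_zero : ∀ y, ∃ N, ∀ n ≥ N, ∀ m, bump n m y = 0
  -- These are the test sets on which bumps are kept away from the zero function.
  isCompact_pts : ∀ h : ℕ → ℕ, IsCompact (insert base {z | ∃ n m, m ≤ h n ∧ z = pt n m})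

/-- An ultrafilter on the set that does not converge to `a` contains a finite set `S \ V`, hence
converges to one of its points. -/
theorem isCompact_insert_of_finite_diff {X : Type*} [TopologicalSpace X] {a : X} {S : Set X}
    (h : ∀ V ∈ 𝓝 a, (S \ V).Finite) : IsCompact (insert a S) := by
  rw [isCompact_iff_ultrafilter_le_nhds]
  intro f hf
  by_cases hfa : (f : Filter X) ≤ 𝓝 a
  · exact ⟨a, Set.mem_insert _ _, hfa⟩
  · obtain ⟨V, hV, hVf⟩ := not_forall₂.1 hfa
    have hmem : S \ V ∈ (f : Filter X) := by
      filter_upwards [le_principal_iff.1 hf, Ultrafilter.compl_mem_iff_notMem.2 hVf] with x hx hxV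
      rcases hx with rfl | hx
      · exact (hxV (mem_of_mem_nhds hV)).elim
      · exact ⟨hx, hxV⟩
    obtain ⟨x, hx, hfx⟩ :=
      (h V hV).isCompact.ultrafilter_le_nhds f (le_principal_iff.2 hmem)
    exact ⟨x, Or.inr hx.1, hfx⟩

theorem exists_seq_no_tendsto_subseq {X : Type*} [MetricSpace X] {a : X} {r : ℝ}
    (h : ¬ IsCompact (Metric.closedBall a r)) :
    ∃ u : ℕ → X, (∀ m, u m ∈ Metric.closedBall a r) ∧ (∀ m, u m ≠ a) ∧
      ∀ (b : X) (k : ℕ → ℕ), StrictMono k → ¬ Tendsto (u ∘ k) atTop (𝓝 b) := by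
  rw [isCompact_iff_isSeqCompact, IsSeqCompact] at h
  push Not at h
  obtain ⟨u, hu, hsub⟩ := h
  have hno (b : X) (k : ℕ → ℕ) (hk : StrictMono k) : ¬ Tendsto (u ∘ k) atTop (𝓝 b) := fun ht =>
    hsub b (Metric.isClosed_closedBall.mem_of_tendsto ht (Eventually.of_forall fun m => hu _)) k
      hk ht
  -- Otherwise a constant subsequence would converge to `a`; the finitely many exceptions are cut
  -- off by the shift `M`.
  have hev : ∀ᶠ m in atTop, u m ≠ a := by
    by_contra hfr
    obtain ⟨k, hk, hka⟩ := extraction_of_frequently_atTop (not_eventually.1 hfr)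
    refine hno a k hk (tendsto_const_nhds.congr fun m => ?_)
    simpa using (not_not.1 (hka m)).symm
  obtain ⟨M, hM⟩ := eventually_atTop.1 hev
  refine ⟨fun m => u (m + M), fun m => hu _, fun m => hM _ (Nat.le_add_left _ _), ?_⟩
  intro b k hk
  exact hno b (fun i => k i + M) (hk.add_const M)

theorem exists_bumpArray {X : Type*} [MetricSpace X] (a : X)
    (ha : ∀ K ∈ 𝓝 a, ¬ IsCompact K) : Nonempty (BumpArray X) := by
  have hr (n : ℕ) : (0 : ℝ) < 1 / (n + 1) := by positivity
  choose u hu hua hno using fun n : ℕ =>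
    exists_seq_no_tendsto_subseq (ha _ (Metric.closedBall_mem_nhds a (hr n)))
  have hdist (n m : ℕ) : 0 < dist (u n m) a := dist_pos.2 (hua n m)
  -- Radii of the bumps: the first bound makes them vanish at `a`, the second makes the supports in
  -- a row shrink.
  obtain ⟨δ, hδ⟩ : ∃ δ : ℕ → ℕ → ℝ, ∀ n m, δ n m = min (dist (u n m) a) (1 / (m + 1)) :=
    ⟨_, fun _ _ => rfl⟩
  have hδ0 (n m : ℕ) : 0 < δ n m := hδ n m ▸ lt_min (hdist n m) (hr m)
  have hδa (n m : ℕ) : δ n m ≤ dist (u n m) a := hδ n m ▸ min_le_left _ _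
  have hδm (n m : ℕ) : δ n m ≤ 1 / (m + 1) := hδ n m ▸ min_le_right _ _
  have hua' (n m : ℕ) : dist (u n m) a ≤ 1 / (n + 1) := hu n m
  obtain ⟨φ, hφ⟩ : ∃ φ : ℕ → ℕ → C(X, ℝ), ∀ n m z,
      φ n m z = (Nat.pair n m + 1) * max 0 (1 - dist z (u n m) / δ n m) :=
    ⟨fun n m => ⟨fun z => (Nat.pair n m + 1) * max 0 (1 - dist z (u n m) / δ n m), by fun_prop⟩,
      fun _ _ _ => rfl⟩
  have hφ0 (n m : ℕ) (z : X) (h : δ n m ≤ dist z (u n m)) : φ n m z = 0 := by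
    rw [hφ, max_eq_left, mul_zero]
    have := (one_le_div (hδ0 n m)).2 h
    linarith
  have hsmall {ε : ℝ} (hε : 0 < ε) : ∃ N : ℕ, ∀ n ≥ N, 1 / ((n : ℝ) + 1) < ε :=
    eventually_atTop.1 (tendsto_one_div_add_atTop_nhds_zero_nat.eventually (gt_mem_nhds hε))
  refine ⟨⟨a, u, φ, fun n m z => ?_, fun n m => ?_, fun n m => ?_, fun K hK n => ?_,
    fun y => ?_, fun h => ?_⟩⟩
  · rw [hφ]
    have h1 : max 0 (1 - dist z (u n m) / δ n m) ≤ 1 :=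
      max_le zero_le_one (sub_le_self _ (div_nonneg dist_nonneg (hδ0 n m).le))
    exact mul_le_of_le_one_right (by positivity) h1
  · simp [hφ]
  · exact hφ0 n m a (by rw [dist_comm]; exact hδa n m)
  -- If `K` met infinitely many supports of a row, a convergent subsequence of the meeting points
  -- would drag the centres `u n m` along, as the radii tend to zero.
  · by_contra hfr
    obtain ⟨k, hk, hkz⟩ := extraction_of_frequently_atTop (not_eventually.1 hfr)
    push Not at hkz
    choose z hzK hz using hkz
    obtain ⟨b, -, l, hl, hb⟩ := hK.tendsto_subseq hzK
    refine hno n b (k ∘ l) (hk.comp hl) (tendsto_of_tendsto_of_dist hb ?_)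
    have h0 : Tendsto (fun i : ℕ => 1 / ((k (l i) : ℝ) + 1)) atTop (𝓝 0) :=
      tendsto_one_div_add_atTop_nhds_zero_nat.comp (hk.comp hl).tendsto_atTop
    refine squeeze_zero (fun _ => dist_nonneg) (fun i => ?_) h0
    exact (not_le.1 fun h => hz (l i) (hφ0 _ _ _ h)).le.trans (hδm n _)
  · by_cases hy : y = a
    · exact ⟨0, fun n _ m => hy ▸ hφ0 n m a (by rw [dist_comm]; exact hδa n m)⟩
    · have hpos : 0 < dist y a / 2 := half_pos (dist_pos.2 hy)
      obtain ⟨N, hN⟩ := hsmall hpos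
      -- Both the centre's distance to `a` and the radius are below `dist y a / 2`.
      refine ⟨N, fun n hn m => hφ0 n m y ?_⟩
      have := dist_triangle y (u n m) a
      linarith [hN n hn, hδa n m, hua' n m]
  · refine isCompact_insert_of_finite_diff fun V hV => ?_
    obtain ⟨ε, hε, hεV⟩ := Metric.mem_nhds_iff.1 hV
    obtain ⟨N, hN⟩ := hsmall hε
    refine (((Set.finite_Iio N).biUnion fun n _ => (Set.finite_Iic (h n)).image (u n))).subset ?_
    rintro z ⟨⟨n, m, hm, rfl⟩, hz⟩
    refine Set.mem_biUnion (x := n) (Set.mem_Iio.2 <| not_le.1 fun hn => hz (hεV ?_)) ⟨m, hm, rfl⟩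
    exact (hua' n m).trans_lt (hN n hn)

/-! ### The maps from `S₂` and `S_ω` into `C_k(X)` -/

namespace BumpArray

open ArensSpace

variable {X : Type*} [TopologicalSpace X] (P : BumpArray X)

/-- The maximum of a bump is its height, and the height encodes the pair of indices. -/
theorem bump_injective {n m n' m' : ℕ} (h : P.bump n m = P.bump n' m') : n = n' ∧ m = m' := by
  have h1 := P.bump_le n' m' (P.pt n m)
  have h2 := P.bump_le n m (P.pt n' m')
  rw [← h, P.bump_pt] at h1
  rw [h, P.bump_pt] at h2
  have h3 : (Nat.pair n m : ℝ) = Nat.pair n' m' := by linarith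
  exact Nat.pair_eq_pair.1 (Nat.cast_injective h3)

/-- The map `S₂ → C(X, ℝ)` sending `(1/n, 0)` to the constant `c/n` and `(1/n, 1/(nm))` to
`c/n` plus a bump function. -/
noncomputable def arensMap (c : ℝ) (p : ArensSpace) : C(X, ℝ) :=
  if p.1.2 = 0 then ContinuousMap.const X (c * p.1.1)
  -- The floors recover `n` and `m` from `(1/n, 1/(nm))`. Both are at least `1`, so row and column
  -- `0` of the array are not used.
  else ContinuousMap.const X (c * p.1.1) + P.bump ⌊1 / p.1.1⌋₊ ⌊p.1.1 / p.1.2⌋₊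

theorem arensMap_spine (c : ℝ) (n : ℕ) :
    P.arensMap c (spine n) = ContinuousMap.const X (c * (1 / (n : ℝ))) :=
  if_pos rfl

theorem arensMap_leaf (c : ℝ) (n m : ℕ) :
    P.arensMap c (leaf n m) =
      ContinuousMap.const X (c * (1 / ((n + 1 : ℕ) : ℝ))) + P.bump (n + 1) (m + 1) := by
  rw [arensMap, if_neg (leaf_snd_ne_zero n m)]
  have h1 : 1 / (leaf n m).1.1 = ((n + 1 : ℕ) : ℝ) := by simp [leaf]
  have h2 : (leaf n m).1.1 / (leaf n m).1.2 = ((m + 1 : ℕ) : ℝ) := by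
    have : ((n + 1 : ℕ) : ℝ) ≠ 0 := by positivity
    have : ((m + 1 : ℕ) : ℝ) ≠ 0 := by positivity
    simp only [leaf]
    field_simp
  rw [h1, h2, Nat.floor_natCast, Nat.floor_natCast]
  rfl

theorem tendsto_bump (n : ℕ) : Tendsto (P.bump n) atTop (𝓝 0) := by
  rw [ContinuousMap.tendsto_iff_forall_isCompact_tendstoUniformlyOn]
  intro K hK ε hε
  filter_upwards [P.eventually_eq_zero K hK n] with m hm z hz
  rw [hm z hz]
  exact refl_mem_uniformity hε

theorem continuous_arensMap (c : ℝ) : Continuous (P.arensMap c) := by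
  refine continuous_of_tendsto ?_ fun n => ?_
  · simp only [arensMap_spine]
    refine (ContinuousMap.continuous_const'.tendsto _).comp ?_
    have h : Tendsto (fun m : ℕ => 1 / ((m + 1 : ℕ) : ℝ)) atTop (𝓝 0) := by
      simpa using tendsto_one_div_add_atTop_nhds_zero_nat (𝕜 := ℝ)
    simpa using h.const_mul c
  · simp only [arensMap_leaf, arensMap_spine]
    have h := (P.tendsto_bump (n + 1)).comp (tendsto_add_atTop_nat 1)
    simpa using (tendsto_const_nhds
      (x := ContinuousMap.const X (c * (1 / ((n + 1 : ℕ) : ℝ))))).add h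

theorem isClosedMap_arensMap {c : ℝ} (hc : 0 ≤ c) : IsClosedMap (P.arensMap c) := by
  intro A hA
  refine isClosed_of_closure_subset fun g hg => ?_
  -- If a neighbourhood of `g` sees only the part of `A` in a compact level, then `g` lies in the
  -- closure of the compact, hence closed, image of that part.
  suffices hloc : g ∉ P.arensMap c '' A →
      ∃ N, ∃ V ∈ 𝓝 g, ∀ p ∈ A, P.arensMap c p ∈ V → p ∈ level N by
    by_contra hgA
    obtain ⟨N, V, hV, hVN⟩ := hloc hgA
    have hclosed : IsClosed (P.arensMap c '' (level N ∩ A)) :=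
      (((isCompact_level N).inter_right hA).image (P.continuous_arensMap c)).isClosed
    refine hgA (Set.image_mono Set.inter_subset_right (hclosed.closure_subset ?_))
    refine mem_closure_iff_nhds.2 fun W hW => ?_
    obtain ⟨_, ⟨hpW, hpV⟩, p, hp, rfl⟩ := mem_closure_iff_nhds.1 hg _ (inter_mem hW hV)
    exact ⟨_, hpW, p, ⟨hVN p hp hpV, hp⟩, rfl⟩
  intro hgA
  by_cases hg0 : g = 0
  · subst hg0
    have hz : spine 0 ∉ A := fun h => hgA ⟨_, h, by
      rw [arensMap_spine]; ext; simp⟩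
    obtain ⟨N, hN⟩ := eventually_atTop.1 (tendsto_spine (hA.isOpen_compl.mem_nhds hz))
    -- As `spine 0 ∉ A`, late points of the spine are outside the closed set `A`, so each late row
    -- has only finitely many leaves in `A`.
    have hrow (n : ℕ) : ∃ M, n ≥ N → ∀ m, leaf n m ∈ A → m < M := by
      by_cases hn : n ≥ N
      · obtain ⟨M, hM⟩ :=
          eventually_atTop.1 (tendsto_leaf n (hA.isOpen_compl.mem_nhds (hN n hn)))
        exact ⟨M, fun _ m hm => not_le.1 fun h => hM m h hm⟩
      · exact ⟨0, fun h => (hn h).elim⟩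
    choose M hM using hrow
    -- The neighbourhood consists of the functions below `1` on a compact set containing the peaks
    -- of all late leaves in `A`; there a leaf's function is at least `1`, since `c ≥ 0`. The shift
    -- `n - 1` appears because `leaf n m` uses bump `(n + 1, m + 1)`.
    refine ⟨N, _, (ContinuousMap.isOpen_setOfPred_mapsTo
      (P.isCompact_pts fun n => M (n - 1)) (isOpen_Iio (a := (1 : ℝ)))).mem_nhds
      fun z _ => by simp, fun p hp hpV => ?_⟩
    rcases eq_spine_or_leaf p with ⟨n, rfl⟩ | ⟨n, m, rfl⟩
    · exact spine_mem_level N n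
    · refine leaf_mem_level (not_le.1 fun hn => ?_) m
      have hlt : P.arensMap c (leaf n m) (P.pt (n + 1) (m + 1)) < 1 :=
        hpV (Or.inr ⟨n + 1, m + 1, hM n hn m hp, rfl⟩)
      rw [arensMap_leaf, ContinuousMap.add_apply, P.bump_pt, ContinuousMap.const_apply] at hlt
      have h1 : 0 ≤ c * (1 / ((n + 1 : ℕ) : ℝ)) := by positivity
      have h2 : (0 : ℝ) ≤ (Nat.pair (n + 1) (m + 1) : ℕ) := Nat.cast_nonneg _
      linarith
  -- Late rows have bumps vanishing at `y`, so their functions take there the small value `c/(n+1)`,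
  -- below `|g y| / 2`.
  · obtain ⟨y, hy⟩ : ∃ y, g y ≠ 0 := by
      by_contra! h
      exact hg0 (ContinuousMap.ext h)
    have hy' : 0 < |g y| := abs_pos.2 hy
    have hlim : Tendsto (fun n : ℕ => c * (1 / ((n + 1 : ℕ) : ℝ))) atTop (𝓝 0) := by
      have h : Tendsto (fun m : ℕ => 1 / ((m + 1 : ℕ) : ℝ)) atTop (𝓝 0) := by
        simpa using tendsto_one_div_add_atTop_nhds_zero_nat (𝕜 := ℝ)
      simpa using h.const_mul c
    obtain ⟨N₁, hN₁⟩ := eventually_atTop.1 (hlim.eventually (gt_mem_nhds (half_pos hy')))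
    obtain ⟨N₂, hN₂⟩ := P.exists_eq_zero y
    have hopen : IsOpen {f : C(X, ℝ) | |g y| / 2 < |f y|} :=
      isOpen_lt continuous_const (continuous_eval_const y).abs
    refine ⟨max N₁ N₂, _, hopen.mem_nhds (half_lt_self hy'), fun p _ hpV => ?_⟩
    rcases eq_spine_or_leaf p with ⟨n, rfl⟩ | ⟨n, m, rfl⟩
    · exact spine_mem_level _ n
    · refine leaf_mem_level (not_le.1 fun hn => ?_) m
      have hlt : |g y| / 2 < |P.arensMap c (leaf n m) y| := hpV
      rw [arensMap_leaf, ContinuousMap.add_apply, ContinuousMap.const_apply,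
        hN₂ _ (((le_max_right _ _).trans hn).trans n.le_succ), add_zero,
        abs_of_nonneg (mul_nonneg hc (by positivity))] at hlt
      exact lt_asymm hlt (hN₁ n ((le_max_left _ _).trans hn))

theorem arensMap_base (c : ℝ) (p : ArensSpace) : P.arensMap c p P.base = c * p.1.1 := by
  rw [arensMap]
  split_ifs <;> simp [P.bump_base]

/-- Evaluating at `base` forces equal constants, and then the peak of the bump tells the two
functions apart. This also works for `c = 0`, as the fan needs. -/
theorem arensMap_spine_ne_leaf {c : ℝ} (k n m : ℕ) :
    P.arensMap c (spine k) ≠ P.arensMap c (leaf n m) := by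
  intro h
  have h1 := congrArg (fun f => f P.base) h
  have h2 := congrArg (fun f => f (P.pt (n + 1) (m + 1))) h
  simp only [arensMap_spine, arensMap_leaf, ContinuousMap.add_apply, ContinuousMap.const_apply,
    P.bump_base, P.bump_pt] at h1 h2
  have h3 : (0 : ℝ) ≤ (Nat.pair (n + 1) (m + 1) : ℕ) := Nat.cast_nonneg _
  linarith

/-- The constants agree at `base` and cancel, leaving equal bumps; for `c = 0` the rows are told
apart by the bumps alone. -/
theorem arensMap_leaf_injective {c : ℝ} {n m n' m' : ℕ}
    (h : P.arensMap c (leaf n m) = P.arensMap c (leaf n' m')) : leaf n m = leaf n' m' := by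
  have h1 := congrArg (fun f => f P.base) h
  simp only [arensMap_base] at h1
  rw [arensMap_leaf, arensMap_leaf] at h
  have h2 : c * (1 / ((n + 1 : ℕ) : ℝ)) = c * (1 / ((n' + 1 : ℕ) : ℝ)) := h1
  rw [h2] at h
  obtain ⟨h3, h4⟩ := P.bump_injective (add_left_cancel h)
  rw [Nat.succ_injective h3, Nat.succ_injective h4]

theorem arensMap_injective {c : ℝ} (hc : c ≠ 0) : Function.Injective (P.arensMap c) := by
  intro p q h
  have h1 := congrArg (fun f => f P.base) h
  simp only [arensMap_base] at h1
  have h2 := mul_left_cancel₀ hc h1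
  rcases eq_spine_or_leaf p with ⟨n, rfl⟩ | ⟨n, m, rfl⟩ <;>
    rcases eq_spine_or_leaf q with ⟨n', rfl⟩ | ⟨n', m', rfl⟩
  · exact Subtype.ext (Prod.ext h2 rfl)
  · exact (P.arensMap_spine_ne_leaf _ _ _ h).elim
  · exact (P.arensMap_spine_ne_leaf _ _ _ h.symm).elim
  · exact P.arensMap_leaf_injective h

theorem isClosedEmbedding_arensMap : IsClosedEmbedding (P.arensMap 1) :=
  .of_continuous_injective_isClosedMap (P.continuous_arensMap 1)
    (P.arensMap_injective one_ne_zero) (P.isClosedMap_arensMap zero_le_one)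

/-- The map `S_ω → C(X, ℝ)` induced by `arensMap 0`. -/
noncomputable def fanMap : SequentialFan → C(X, ℝ) :=
  Quotient.lift (P.arensMap 0) <| by
    rintro p q (rfl | ⟨hp, hq⟩)
    · rfl
    · obtain ⟨n, rfl⟩ := exists_spine_of_mem_range hp
      obtain ⟨m, rfl⟩ := exists_spine_of_mem_range hq
      simp [arensMap_spine]

theorem fanMap_mk (p : ArensSpace) : P.fanMap (Quotient.mk fanSetoid p) = P.arensMap 0 p := rfl

theorem continuous_fanMap : Continuous P.fanMap :=
  (P.continuous_arensMap 0).quotient_lift _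

/-- The image of `A` is the image under `arensMap 0` of the closed preimage of `A` in `S₂`. -/
theorem isClosedMap_fanMap : IsClosedMap P.fanMap := by
  intro A hA
  have hmk : Continuous (Quotient.mk fanSetoid : ArensSpace → SequentialFan) :=
    continuous_quotient_mk'
  convert P.isClosedMap_arensMap le_rfl _ (hA.preimage hmk) using 1
  ext g
  constructor
  · rintro ⟨p, hp, rfl⟩
    obtain ⟨p, rfl⟩ := Quotient.exists_rep p
    exact ⟨p, hp, rfl⟩
  · rintro ⟨p, hp, rfl⟩
    exact ⟨_, hp, rfl⟩

theorem fanMap_injective : Function.Injective P.fanMap := by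
  intro p q h
  obtain ⟨p, rfl⟩ := Quotient.exists_rep p
  obtain ⟨q, rfl⟩ := Quotient.exists_rep q
  rw [fanMap_mk, fanMap_mk] at h
  refine Quotient.sound (s := fanSetoid) ?_
  rcases eq_spine_or_leaf p with ⟨n, rfl⟩ | ⟨n, m, rfl⟩ <;>
    rcases eq_spine_or_leaf q with ⟨n', rfl⟩ | ⟨n', m', rfl⟩
  · exact Or.inr ⟨spine_mem_range n, spine_mem_range n'⟩
  · exact (P.arensMap_spine_ne_leaf _ _ _ h).elim
  · exact (P.arensMap_spine_ne_leaf _ _ _ h.symm).elim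
  · exact Or.inl (P.arensMap_leaf_injective h)

theorem isClosedEmbedding_fanMap : IsClosedEmbedding P.fanMap :=
  .of_continuous_injective_isClosedMap P.continuous_fanMap P.fanMap_injective
    P.isClosedMap_fanMap

end BumpArray

/-! ### Conclusion -/

/-- In an R1 space one compact neighbourhood at each point already gives local compactness. -/
theorem exists_forall_nhds_not_isCompact {X : Type*} [TopologicalSpace X] [R1Space X]
    (hX : ¬ LocallyCompactSpace X) : ∃ a : X, ∀ K ∈ 𝓝 a, ¬ IsCompact K := by
  by_contra! h
  have : WeaklyLocallyCompactSpace X :=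
    ⟨fun x => let ⟨K, hK, hc⟩ := h x; ⟨K, hc, hK⟩⟩
  exact hX inferInstance

/-- Here `C(X, ℝ)` carries Mathlib's compact-open topology, i.e. it is `C_k(X)`. -/
theorem theorem2p2 {X : Type*} [TopologicalSpace X] [TopologicalSpace.MetrizableSpace X]
    (hX : ¬ LocallyCompactSpace X) :
    ContainsClosedCopy ArensSpace C(X, ℝ) ∧
      ContainsClosedCopy SequentialFan C(X, ℝ) ∧
      ¬ PropertyAP C(X, ℝ) := by
  let _ := TopologicalSpace.metrizableSpaceMetric X
  obtain ⟨a, ha⟩ := exists_forall_nhds_not_isCompact hX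
  obtain ⟨P⟩ := exists_bumpArray a ha
  exact ⟨P.isClosedEmbedding_arensMap.containsClosedCopy,
    P.isClosedEmbedding_fanMap.containsClosedCopy,
    fun h => ArensSpace.not_propertyAP (h.of_isClosedEmbedding P.isClosedEmbedding_arensMap)⟩
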